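/- Let $\mathcal M=(\mathcal S,\mathcal A,\mathcal P,\mathcal R)$ be a finite MDP in which every action is admissible in every state, with $|\mathcal S||\mathcal A|\ge 2$, deterministic dynamics (every $\mathcal P(\cdot\mid s,a)$ is a point mass) and $|\mathcal R|\le R_{\max}$, where $R_{\max}>0$. Let $\gamma\in[0,1)$ be the discount factor. For a delay $\Delta\in\mathbb N$ (including $0$) let $\mathcal M_\Delta$ be the regular reformulation with augmented states $x=(s_0,a_1,\dots,a_\Delta)\in\mathcal X=\mathcal S\times\mathcal A^\Delta$: under a new action $a$ the state moves to $(s',a_2,\dots,a_\Delta,a)$ with $s'\sim\mathcal P(\cdot\mid s_0,a_1)$ (for $\Delta=0$, $s'\sim\mathcal P(\cdot\mid s_0,a)$), and the reward is $\mathbb E_{s\sim b_\Delta(\cdot\mid x)}[\mathcal R(s,a)]$, where the belief $b_\Delta(\cdot\mid x)$ is the law of the state reached from $s_0$ by the actions $a_1,\dots,a_\Delta$. Let the abstract MDP $\bar{\mathcal M}_\Delta$ be the quotient of $\mathcal M_\Delta$ by belief-equivalence ($x\equiv x'$ iff $b_\Delta(\cdot\mid x)=b_\Delta(\cdot\mid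 x')$), with action set $\mathcal A$. Synchronous Q-learning on an MDP with kernel $P$ and reward $R$, with learning rates $\alpha_t=(t+1)^{-\omega}$ and initial table $Q_0$ satisfying $\|Q_0\|_\infty\le R_{\max}/(1-\gamma)$, is $$Q_{t+1}(s,a)=(1-\alpha_t)Q_t(s,a)+\alpha_t\bigl(R(s,a)+\gamma\max_{b}Q_t(y_t(s,a),b)\bigr),$$ with independent samples $y_t(s,a)\sim P(\cdot\mid s,a)$. Its sample complexity $N(\varepsilon,\delta)$ is the least number $N$ of samples per state-action pair (equivalently, of iterations) such that for every $T\ge N$, with probability at least $1-\delta$, one has $\|Q_T-Q^*\|_\infty\le\varepsilon$ and every greedy policy $\pi$ for $Q_T$ is $\varepsilon$-optimal, i.e. $V^\pi(s)\ge V^*(s)-\varepsilon$ for all $s$. Then for every $\omega\in[0,4/5)$ there is a constant $C>0$, depending only on $\omega$ and $R_{\max}$ (in particular not on $\Delta,\mathcal S,\mathcal A,\mathcal M,\gamma,\varepsilon,\delta,Q_0$), such that for all $\varepsilon\in(0,1]$ and $\delta\in(0,1)$ the sample complexity of Q-learning on $\bar{\mathcal M}_\Delta$, for every $\Delta$, satisfies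 $$N(\varepsilon,\delta)\le C\,\frac{\log(|\mathcal S||\mathcal A|)}{\varepsilon^{2.5}(1-\gamma)^5},$$ and Q-learning on the delay-free MDP $\mathcal M$ satisfies the same bound with the same $C$. For the boundary rate $\omega=4/5$ both bounds hold, with a $C$ depending only on $R_{\max}$, after multiplication of the right-hand side by $\bigl(1+\log\frac1{1-\gamma}\bigr)^5$. -/

import Mathlib

open MeasureTheory
open scoped ENNReal

universe u v

/-- A Markov decision process with states `S`, actions `A` (every action is admissible in every
state), transition kernel `P` and reward function `R`.  It is finite when `S` and `A` are. -/
structure FiniteMDP (S : Type u) (A : Type v) where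
  /-- `P s a` is the law of the next state. -/
  P : S → A → PMF S
  /-- `R s a` is the reward for taking action `a` in state `s`. -/
  R : S → A → ℝ

namespace FiniteMDP

section Basic

variable {S : Type u} {A : Type v}

/-- The dynamics are deterministic: each state-action pair has exactly one successor. -/
def IsDeterministic (M : FiniteMDP S A) : Prop :=
  ∀ s a, ∃ s', M.P s a = PMF.pure s'

/-! ### Policies, value functions and optimality -/

/-- The law of the state-action pair at time `k`, when the pair at time `0` has law `μ` and all
later actions are drawn from the policy `π`. -/
noncomputable def pairLaw (M : FiniteMDP S A) (π : S → PMF A) (μ : PMF (S × A)) :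
    ℕ → PMF (S × A)
  | 0 => μ
  | k + 1 => (pairLaw M π μ k).bind fun z =>
      (M.P z.1 z.2).bind fun s => (π s).map fun a => (s, a)

/-- The expected discounted return `𝔼 [∑ₖ γᵏ rₖ] = ∑ₖ γᵏ 𝔼 [rₖ]`, when the pair at time `0` has
law `μ` and all later actions are drawn from `π`. -/
noncomputable def expectedReturn [Fintype S] [Fintype A] (M : FiniteMDP S A) (γ : ℝ)
    (π : S → PMF A) (μ : PMF (S × A)) : ℝ :=
  ∑' k : ℕ, γ ^ k * ∑ z : S × A, (M.pairLaw π μ k z).toReal * M.R z.1 z.2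

/-- The state-value function `V^π`. -/
noncomputable def stateValue [Fintype S] [Fintype A] (M : FiniteMDP S A) (γ : ℝ)
    (π : S → PMF A) (s : S) : ℝ :=
  M.expectedReturn γ π ((π s).map fun a => (s, a))

/-- The action-value function `Q^π`. -/
noncomputable def actionValue [Fintype S] [Fintype A] (M : FiniteMDP S A) (γ : ℝ)
    (π : S → PMF A) (s : S) (a : A) : ℝ :=
  M.expectedReturn γ π (PMF.pure (s, a))

/-- The optimal state-value function `V^*`, the supremum of `V^π` over all policies. -/
noncomputable def optStateValue [Fintype S] [Fintype A] (M : FiniteMDP S A) (γ : ℝ)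
    (s : S) : ℝ :=
  ⨆ π : S → PMF A, M.stateValue γ π s

/-- The optimal action-value function `Q^*`, the supremum of `Q^π` over all policies. -/
noncomputable def optActionValue [Fintype S] [Fintype A] (M : FiniteMDP S A) (γ : ℝ)
    (s : S) (a : A) : ℝ :=
  ⨆ π : S → PMF A, M.actionValue γ π s a

/-- The policy `π` is `ε`-optimal: from every state it loses at most `ε` against `V^*`. -/
def IsEpsOptimal [Fintype S] [Fintype A] (M : FiniteMDP S A) (γ ε : ℝ) (π : S → PMF A) : Prop :=
  ∀ s, M.optStateValue γ s - ε ≤ M.stateValue γ π s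

/-- The policy `π` is greedy for `Q`: it only plays actions that maximize `Q s`.  Ties may be
broken in any way. -/
def IsGreedy (Q : S → A → ℝ) (π : S → PMF A) : Prop :=
  ∀ s a, a ∈ (π s).support → ∀ b, Q s b ≤ Q s a

/-! ### Q-learning and its sample complexity -/

/-- The law of the samples used by Q-learning: independent draws `y (t, s, a) ∼ P(· | s, a)`, one
for each iteration `t` and each state-action pair `(s, a)`. -/
noncomputable def sampleLaw (M : FiniteMDP S A) : @Measure (ℕ × S × A → S)
    (@MeasurableSpace.pi (ℕ × S × A) (fun _ => S) (fun _ => ⊤)) :=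
  letI : MeasurableSpace S := ⊤
  Measure.infinitePi fun i : ℕ × S × A => (M.P i.2.1 i.2.2).toMeasure

/-- The (synchronous) Q-learning iterates with learning rates `α`, started at `Q₀` and run on the
samples `y`:
`Q_{t+1}(s,a) = (1 - α_t) Q_t(s,a) + α_t (R(s,a) + γ max_b Q_t(y_t(s,a), b))`. -/
noncomputable def qLearning (M : FiniteMDP S A) (γ : ℝ) (α : ℕ → ℝ) (Q₀ : S → A → ℝ)
    (y : ℕ × S × A → S) : ℕ → S → A → ℝ
  | 0 => Q₀
  | t + 1 => fun s a =>
      (1 - α t) * qLearning M γ α Q₀ y t s a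
        + α t * (M.R s a + γ * ⨆ b, qLearning M γ α Q₀ y t (y (t, s, a)) b)

/-- The `t`-th Q-learning iterate is `ε`-accurate on the samples `y`: it is uniformly `ε`-close to
`Q^*`, and each of its greedy policies is `ε`-optimal. -/
def QLearningSucceeds [Fintype S] [Fintype A] (M : FiniteMDP S A) (γ : ℝ) (α : ℕ → ℝ)
    (Q₀ : S → A → ℝ) (ε : ℝ) (t : ℕ) (y : ℕ × S × A → S) : Prop :=
  (∀ s a, |M.qLearning γ α Q₀ y t s a - M.optActionValue γ s a| ≤ ε) ∧
    ∀ π : S → PMF A, IsGreedy (M.qLearning γ α Q₀ y t) π → M.IsEpsOptimal γ ε π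

/-- The sample complexity of Q-learning at accuracy `ε` and confidence `1 - δ`: the least number
`N` of samples per state-action pair (that is, of synchronous iterations) such that after any
number `T ≥ N` of them the iterate is `ε`-accurate with probability at least `1 - δ`.
It is `⊤` if there is no such `N`. -/
noncomputable def sampleComplexity [Fintype S] [Fintype A] (M : FiniteMDP S A) (γ : ℝ)
    (α : ℕ → ℝ) (Q₀ : S → A → ℝ) (ε δ : ℝ) : ℕ∞ :=
  ⨅ N ∈ {N : ℕ | ∀ T, N ≤ T →
    ENNReal.ofReal (1 - δ) ≤ M.sampleLaw {y | M.QLearningSucceeds γ α Q₀ ε T y}}, (N : ℕ∞)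

/-! ### Quotients of MDPs -/

/-- The partition of `S × A` with blocks `[s] × {a}`, for the classes `[s]` of `r`, is
reward-respecting. -/
def IsRewardRespecting (M : FiniteMDP S A) (r : Setoid S) : Prop :=
  ∀ s₁ s₂, r s₁ s₂ → ∀ a, M.R s₁ a = M.R s₂ a

/-- The partition of `S × A` with blocks `[s] × {a}`, for the classes `[s]` of `r`, has the
stochastic substitution property: equivalent states have, under the same action, the same
probability of moving into each class of `r`. -/
def HasSSP (M : FiniteMDP S A) (r : Setoid S) : Prop :=
  ∀ s₁ s₂, r s₁ s₂ → ∀ a,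
    (M.P s₁ a).map (Quotient.mk r) = (M.P s₂ a).map (Quotient.mk r)

/-- The quotient of an MDP by a reward-respecting partition with the stochastic substitution
property: `R̄([s], a) = R(s, a)` and `P̄([s'] | [s], a) = ∑_{s'' ∈ [s']} P(s'' | s, a)`. -/
noncomputable def quotient (M : FiniteMDP S A) (r : Setoid S) (hR : M.IsRewardRespecting r)
    (hP : M.HasSSP r) : FiniteMDP (Quotient r) A where
  P x a := Quotient.lift (fun s => (M.P s a).map (Quotient.mk r))
    (fun s₁ s₂ h => hP s₁ s₂ h a) x
  R x a := Quotient.lift (fun s => M.R s a) (fun s₁ s₂ h => hR s₁ s₂ h a) x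

end Basic

/-! ### Delayed MDPs -/

section Delay

variable {S : Type u} {A : Type v}

/-- The augmented states `X = S × A^Δ`: the last observed state `s_{t-Δ}`, together with the last
`Δ` actions `a_{t-Δ}, …, a_{t-1}`, oldest first. -/
abbrev AugState (S : Type u) (A : Type v) (Δ : ℕ) : Type (max u v) := S × (Fin Δ → A)

/-- The law of the state reached from `s` by the actions `q 0, …, q (Δ - 1)`. -/
noncomputable def beliefFrom (M : FiniteMDP S A) : (Δ : ℕ) → S → (Fin Δ → A) → PMF S
  | 0, s, _ => PMF.pure s
  | Δ + 1, s, q => (M.P s (q 0)).bind fun s' => beliefFrom M Δ s' (Fin.tail q)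

/-- The belief `b_Δ(· | x)`: the law of the current state given the augmented state `x`. -/
noncomputable def belief (M : FiniteMDP S A) (Δ : ℕ) (x : AugState S A Δ) : PMF S :=
  M.beliefFrom Δ x.1 x.2

/-- The regular (delay-free) reformulation of the delayed MDP `(M, Δ)`.  When action `a` is taken
in the augmented state `(s, q)`, the observed state moves by the oldest of the actions `q, a`,
which is then dropped from the queue; the reward is the expectation of `R(·, a)` under the
belief. -/
noncomputable def augmented [Fintype S] (M : FiniteMDP S A) (Δ : ℕ) :
    FiniteMDP (AugState S A Δ) A where
  P x a :=
    let q' : Fin (Δ + 1) → A := Fin.snoc (α := fun _ => A) x.2 a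
    (M.P x.1 (q' 0)).map fun s' => (s', Fin.tail q')
  R x a := ∑ s : S, (M.belief Δ x s).toReal * M.R s a

/-- Belief-equivalence of augmented states: they induce the same belief. -/
noncomputable def beliefSetoid (M : FiniteMDP S A) (Δ : ℕ) : Setoid (AugState S A Δ) :=
  Setoid.ker (M.belief Δ)

theorem augmented_isRewardRespecting [Fintype S] (M : FiniteMDP S A) (Δ : ℕ) :
    (M.augmented Δ).IsRewardRespecting (M.beliefSetoid Δ) := by
  intro x y h a
  have h' : M.belief Δ x = M.belief Δ y := h
  simp only [augmented, h']

/-- Pushing one more action through the belief. -/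
theorem beliefFrom_snoc (M : FiniteMDP S A) (Δ : ℕ) :
    ∀ (s : S) (q : Fin Δ → A) (a : A),
      M.beliefFrom (Δ + 1) s (Fin.snoc (α := fun _ => A) q a)
        = (M.beliefFrom Δ s q).bind fun s' => M.P s' a := by
  induction Δ with
  | zero =>
    intro s q a
    have h0 : (Fin.snoc (α := fun _ => A) q a : Fin 1 → A) 0 = a :=
      Fin.snoc_last (α := fun _ => A) a q
    simp only [beliefFrom, h0, PMF.pure_bind, PMF.bind_pure]
  | succ n ih =>
    intro s q a
    have h0 : (Fin.snoc (α := fun _ => A) q a : Fin (n + 2) → A) 0 = q 0 :=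
      Fin.snoc_castSucc (α := fun _ => A) a q 0
    have ht : Fin.tail (Fin.snoc (α := fun _ => A) q a : Fin (n + 2) → A)
        = Fin.snoc (α := fun _ => A) (Fin.tail q) a := by
      ext i
      refine Fin.lastCases ?_ (fun j => ?_) i
      · rw [Fin.snoc_last]
        show (Fin.snoc (α := fun _ => A) q a : Fin (n + 2) → A) (Fin.last n).succ = a
        rw [Fin.succ_last]
        exact Fin.snoc_last (α := fun _ => A) a q
      · rw [Fin.snoc_castSucc]
        show (Fin.snoc (α := fun _ => A) q a : Fin (n + 2) → A) j.castSucc.succ = q j.succ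
        rw [← Fin.castSucc_succ]
        exact Fin.snoc_castSucc (α := fun _ => A) a q j.succ
    rw [beliefFrom, h0, ht]
    conv_rhs => rw [beliefFrom, PMF.bind_bind]
    congr 1
    funext s'
    exact ih s' (Fin.tail q) a

theorem augmented_hasSSP [Fintype S] (M : FiniteMDP S A) (hM : M.IsDeterministic) (Δ : ℕ) :
    (M.augmented Δ).HasSSP (M.beliefSetoid Δ) := by
  intro x y h a
  have h' : M.belief Δ x = M.belief Δ y := h
  have key : ∀ z : AugState S A Δ, ∃ w : AugState S A Δ,
      (M.augmented Δ).P z a = PMF.pure w ∧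
        M.belief Δ w = (M.belief Δ z).bind fun s => M.P s a := by
    intro z
    obtain ⟨s', hs'⟩ := hM z.1 ((Fin.snoc (α := fun _ => A) z.2 a : Fin (Δ + 1) → A) 0)
    refine ⟨(s', Fin.tail (Fin.snoc (α := fun _ => A) z.2 a : Fin (Δ + 1) → A)), ?_, ?_⟩
    · simp only [augmented, hs', PMF.pure_map]
    · have := M.beliefFrom_snoc Δ z.1 z.2 a
      rw [beliefFrom, hs', PMF.pure_bind] at this
      exact this
  obtain ⟨w₁, hw₁, hb₁⟩ := key x
  obtain ⟨w₂, hw₂, hb₂⟩ := key y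
  rw [hw₁, hw₂, PMF.pure_map, PMF.pure_map]
  congr 1
  refine Quotient.sound (s := M.beliefSetoid Δ) ?_
  show M.belief Δ w₁ = M.belief Δ w₂
  rw [hb₁, hb₂, h']

/-- The abstract states: the classes of augmented states under belief-equivalence. -/
abbrev AbstractState (M : FiniteMDP S A) (Δ : ℕ) : Type (max u v) :=
  Quotient (M.beliefSetoid Δ)

noncomputable instance abstractStateFintype [Fintype S] [Fintype A] (M : FiniteMDP S A) (Δ : ℕ) :
    Fintype (M.AbstractState Δ) :=
  Fintype.ofFinite _

/-- The abstract MDP: the quotient of the regular reformulation of `(M, Δ)` by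
belief-equivalence, for deterministic dynamics. -/
noncomputable def abstractMDP [Fintype S] (M : FiniteMDP S A) (hM : M.IsDeterministic) (Δ : ℕ) :
    FiniteMDP (M.AbstractState Δ) A :=
  (M.augmented Δ).quotient (M.beliefSetoid Δ) (M.augmented_isRewardRespecting Δ)
    (M.augmented_hasSSP hM Δ)

end Delay

end FiniteMDP

/-- The polynomial learning rate `α_t = 1 / (t + 1)^ω`. -/
noncomputable def polyRate (ω : ℝ) (t : ℕ) : ℝ := 1 / ((t : ℝ) + 1) ^ ω

/-! Deterministic dynamics remove all randomness: almost surely every sample is the true successor,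
so Q-learning is damped value iteration and neither `δ` nor the number of states plays a role. Each
step shrinks the sup-distance to the Bellman fixed point by a factor at most `1 - α (1 - γ)`. Since
the first `t` rates sum to at least `t ^ (1 - ω)`, the error is at most `2 r / (1 - γ) * exp (-(1 -
γ) t ^ (1 - ω))` (`IsBellmanFixed.abs_qLearning_sub_le`, `rpow_le_sum_polyRate`).

A greedy policy for a table with error `e` loses at most `2 e / (1 - γ)`, so `e = ε (1 - γ) / 2`
suffices (`IsGreedy.isEpsOptimal`). With `u = 1 - γ`, `p = 1 - ω` and `W` of order `ε ^ (-2.5) u ^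
(-5)`, the exponent `u W ^ p` is of order `ε ^ (-2.5 p) u ^ (-(5 p - 1))`. It dominates `log (4 r /
(ε u ^ 2))` when `5 p > 1`, that is `ω < 4 / 5`; at equality the power of `u` disappears and a
logarithm must replace it.

The abstract MDP is again deterministic with the same reward bound, so one estimate covers both
claims. -/

/-- The expectation of a real function under a probability mass function on a finite type. -/
noncomputable def PMF.finExp {α : Type*} [Fintype α] (p : PMF α) (h : α → ℝ) : ℝ :=
  ∑ z, (p z).toReal * h z

/-! ### Expectations on finite types -/

namespace PMF

variable {α β : Type*} [Fintype α] [Fintype β]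

theorem sum_toReal (p : PMF α) : ∑ z, (p z).toReal = 1 := by
  rw [← ENNReal.toReal_sum fun z _ => p.apply_ne_top z,
    ← tsum_fintype (L := SummationFilter.unconditional α), p.tsum_coe, ENNReal.toReal_one]

/-- Expectations under a `bind` are iterated expectations. -/
theorem finExp_bind (p : PMF α) (f : α → PMF β) (h : β → ℝ) :
    (p.bind f).finExp h = p.finExp fun z => (f z).finExp h := by
  have hb : ∀ w, ((p.bind f) w).toReal = ∑ z, (p z).toReal * (f z w).toReal := by
    intro w
    rw [PMF.bind_apply, tsum_fintype, ENNReal.toReal_sum]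
    · simp only [ENNReal.toReal_mul]
    · exact fun z _ => ENNReal.mul_ne_top (p.apply_ne_top z) ((f z).apply_ne_top w)
  simp only [finExp, hb, Finset.sum_mul, Finset.mul_sum]
  rw [Finset.sum_comm]
  simp only [mul_assoc]

theorem finExp_pure (z : α) (h : α → ℝ) : (PMF.pure z).finExp h = h z := by
  classical
  rw [finExp, Finset.sum_eq_single z]
  · simp
  · intro w _ hw
    simp [PMF.pure_apply, hw]
  · simp

theorem finExp_map (p : PMF α) (f : α → β) (h : β → ℝ) :
    (p.map f).finExp h = p.finExp (h ∘ f) := by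
  rw [← PMF.bind_pure_comp, finExp_bind]
  simp only [Function.comp_apply, finExp_pure]
  rfl

theorem finExp_const (p : PMF α) (c : ℝ) : (p.finExp fun _ => c) = c := by
  rw [finExp, ← Finset.sum_mul, p.sum_toReal, one_mul]

/-- Greediness constrains a policy only on its support, hence this form. -/
theorem finExp_mono_of_support (p : PMF α) {h g : α → ℝ} (hg : ∀ z ∈ p.support, h z ≤ g z) :
    p.finExp h ≤ p.finExp g := by
  refine Finset.sum_le_sum fun z _ => ?_
  by_cases hz : z ∈ p.support
  · exact mul_le_mul_of_nonneg_left (hg z hz) ENNReal.toReal_nonneg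
  · simp [(p.apply_eq_zero_iff z).2 hz]

theorem finExp_mono (p : PMF α) {h g : α → ℝ} (hg : ∀ z, h z ≤ g z) :
    p.finExp h ≤ p.finExp g :=
  p.finExp_mono_of_support fun z _ => hg z

theorem abs_finExp_le (p : PMF α) {h : α → ℝ} {c : ℝ} (hc : ∀ z, |h z| ≤ c) :
    |p.finExp h| ≤ c := by
  rw [abs_le]
  constructor
  · rw [← p.finExp_const (-c)]
    exact p.finExp_mono fun z => (abs_le.1 (hc z)).1
  · rw [← p.finExp_const c]
    exact p.finExp_mono fun z => (abs_le.1 (hc z)).2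

end PMF

namespace FiniteMDP

variable {S : Type*} {A : Type*}

/-! ### Policy evaluation through Bellman residuals -/

section Evaluation

variable [Fintype S] [Fintype A] (M : FiniteMDP S A) (γ : ℝ) (π : S → PMF A)

/-- The expectation of `h` at the next state-action pair under the policy `π`. -/
noncomputable def nextExp (h : S × A → ℝ) (z : S × A) : ℝ :=
  (M.P z.1 z.2).finExp fun s => (π s).finExp fun a => h (s, a)

theorem finExp_pairLaw_succ (μ : PMF (S × A)) (h : S × A → ℝ) (k : ℕ) :
    (M.pairLaw π μ (k + 1)).finExp h = (M.pairLaw π μ k).finExp (M.nextExp π h) := by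
  simp only [pairLaw, PMF.finExp_bind, PMF.finExp_map]
  rfl

theorem expectedReturn_eq (μ : PMF (S × A)) :
    M.expectedReturn γ π μ =
      ∑' k : ℕ, γ ^ k * (M.pairLaw π μ k).finExp fun z => M.R z.1 z.2 := rfl

theorem summable_discounted {γ : ℝ} (h0 : 0 ≤ γ) (h1 : γ < 1) (μ : ℕ → PMF (S × A))
    (h : S × A → ℝ) : Summable fun k : ℕ => γ ^ k * (μ k).finExp h := by
  obtain ⟨c, hc⟩ : ∃ c, ∀ z, |h z| ≤ c := by
    refine ⟨∑ z, |h z|, fun z => ?_⟩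
    exact Finset.single_le_sum (f := fun z => |h z|) (fun _ _ => abs_nonneg _) (Finset.mem_univ z)
  refine Summable.of_norm_bounded ((summable_geometric_of_lt_one h0 h1).mul_right c) fun k => ?_
  rw [Real.norm_eq_abs, abs_mul, abs_of_nonneg (pow_nonneg h0 k)]
  exact mul_le_mul_of_nonneg_left ((μ k).abs_finExp_le hc) (pow_nonneg h0 k)

theorem _root_.tsum_add_succ_sub {a b : ℕ → ℝ} (ha : Summable a) (hb : Summable b) :
    ∑' k, (a k + b (k + 1) - b k) = (∑' k, a k) - b 0 := by
  have hb' : Summable fun k => b (k + 1) := (summable_nat_add_iff 1).2 hb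
  have h₁ := (ha.add hb').tsum_sub hb
  have h₂ := ha.tsum_add hb'
  have h₃ := hb.tsum_eq_zero_add
  linarith

/-- The return of a policy compared with an arbitrary potential `h`. -/
theorem expectedReturn_sub {γ : ℝ} (h0 : 0 ≤ γ) (h1 : γ < 1) (μ : PMF (S × A)) (h : S × A → ℝ) :
    M.expectedReturn γ π μ - μ.finExp h =
      ∑' k : ℕ, γ ^ k * (M.pairLaw π μ k).finExp
        fun z => M.R z.1 z.2 + γ * M.nextExp π h z - h z := by
  have hs := summable_discounted h0 h1 (M.pairLaw π μ)
  -- The discounted residual is the discounted reward plus a difference of consecutive discounted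
  -- potentials, so the series telescopes.
  have hsplit : ∀ k : ℕ, γ ^ k * ((M.pairLaw π μ k).finExp
        fun z => M.R z.1 z.2 + γ * M.nextExp π h z - h z) =
      γ ^ k * ((M.pairLaw π μ k).finExp fun z => M.R z.1 z.2)
        + γ ^ (k + 1) * (M.pairLaw π μ (k + 1)).finExp h
        - γ ^ k * (M.pairLaw π μ k).finExp h := by
    intro k
    rw [finExp_pairLaw_succ]
    simp only [PMF.finExp, mul_add, mul_sub, Finset.sum_add_distrib, Finset.sum_sub_distrib,
      Finset.mul_sum]
    congr 2
    refine Finset.sum_congr rfl fun z _ => ?_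
    ring
  have h0' : γ ^ 0 * (M.pairLaw π μ 0).finExp h = μ.finExp h := by simp [pairLaw]
  rw [tsum_congr hsplit, expectedReturn_eq, tsum_add_succ_sub (hs _) (hs h), h0']

/-- The residual of a supersolution is nonpositive at every time. -/
theorem expectedReturn_le {γ : ℝ} (h0 : 0 ≤ γ) (h1 : γ < 1) (μ : PMF (S × A)) {h : S × A → ℝ}
    (hh : ∀ z, M.R z.1 z.2 + γ * M.nextExp π h z ≤ h z) :
    M.expectedReturn γ π μ ≤ μ.finExp h := by
  rw [← sub_nonpos, M.expectedReturn_sub π h0 h1 μ h]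
  refine tsum_nonpos fun k => mul_nonpos_of_nonneg_of_nonpos (pow_nonneg h0 k) ?_
  rw [← (M.pairLaw π μ k).finExp_const 0]
  exact PMF.finExp_mono _ fun z => by linarith [hh z]

/-- A residual of at least `-c` at every time costs at most `∑ γ ^ k * c`. -/
theorem le_expectedReturn {γ : ℝ} (h0 : 0 ≤ γ) (h1 : γ < 1) (μ : PMF (S × A)) {h : S × A → ℝ}
    {c : ℝ} (hh : ∀ z, h z - c ≤ M.R z.1 z.2 + γ * M.nextExp π h z) :
    μ.finExp h - c / (1 - γ) ≤ M.expectedReturn γ π μ := by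
  have key : ∑' k : ℕ, γ ^ k * -c ≤ M.expectedReturn γ π μ - μ.finExp h := by
    rw [M.expectedReturn_sub π h0 h1 μ h]
    refine Summable.tsum_le_tsum (fun k => mul_le_mul_of_nonneg_left ?_ (pow_nonneg h0 k))
      ((summable_geometric_of_lt_one h0 h1).mul_right _) (summable_discounted h0 h1 _ _)
    rw [← (M.pairLaw π μ k).finExp_const (-c)]
    exact PMF.finExp_mono _ fun z => by linarith [hh z]
  rw [tsum_mul_right, tsum_geometric_of_lt_one h0 h1] at key
  have : (1 - γ)⁻¹ * -c = -(c / (1 - γ)) := by ring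
  linarith

end Evaluation

theorem finite_le_ciSup [Finite A] (q : A → ℝ) (a : A) : q a ≤ ⨆ b, q b :=
  le_ciSup (Set.finite_range q).bddAbove a

theorem ciSup_le_ciSup_add [Finite A] [Nonempty A] {q q' : A → ℝ} {c : ℝ}
    (h : ∀ a, |q a - q' a| ≤ c) : ⨆ b, q b ≤ (⨆ b, q' b) + c :=
  ciSup_le fun b => by linarith [(abs_le.1 (h b)).2, finite_le_ciSup q' b]

theorem abs_ciSup_sub_ciSup_le [Finite A] [Nonempty A] {q q' : A → ℝ} {c : ℝ}
    (h : ∀ a, |q a - q' a| ≤ c) : |(⨆ b, q b) - ⨆ b, q' b| ≤ c := by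
  have h₁ := ciSup_le_ciSup_add h
  have h₂ := ciSup_le_ciSup_add (q := q') (q' := q) fun a => by rw [abs_sub_comm]; exact h a
  exact abs_le.2 ⟨by linarith, by linarith⟩

/-! ### Bellman equation, greedy policies and Q-learning under deterministic dynamics -/

section Deterministic

variable [Fintype S] [Fintype A] [Nonempty A] {M : FiniteMDP S A} {γ : ℝ} {f : S → A → S}

/-- `q` solves the Bellman optimality equation of the MDP with transition function `f`. -/
def IsBellmanFixed (M : FiniteMDP S A) (γ : ℝ) (f : S → A → S) (q : S → A → ℝ) : Prop :=
  ∀ s a, q s a = M.R s a + γ * ⨆ b, q (f s a) b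

theorem exists_isBellmanFixed (M : FiniteMDP S A) (f : S → A → S) (h0 : 0 ≤ γ) (h1 : γ < 1) :
    ∃ q, IsBellmanFixed M γ f q := by
  let F : (S → A → ℝ) → S → A → ℝ := fun q s a => M.R s a + γ * ⨆ b, q (f s a) b
  have hF : ContractingWith ⟨γ, h0⟩ F := by
    refine ⟨by exact_mod_cast h1, LipschitzWith.of_dist_le_mul fun q q' => ?_⟩
    have hnn : 0 ≤ γ * dist q q' := mul_nonneg h0 dist_nonneg
    refine (dist_pi_le_iff hnn).2 fun s => (dist_pi_le_iff hnn).2 fun a => ?_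
    have hd : ∀ b, |q (f s a) b - q' (f s a) b| ≤ dist q q' := fun b =>
      (dist_le_pi_dist (q (f s a)) (q' (f s a)) b).trans (dist_le_pi_dist q q' _)
    have := mul_le_mul_of_nonneg_left (abs_ciSup_sub_ciSup_le hd) h0
    rw [Real.dist_eq]
    -- `γ` is turned into `|γ|` to enter the absolute value; the reward is then added to both terms,
    -- where it cancels.
    rwa [← abs_of_nonneg h0, ← abs_mul, abs_of_nonneg h0, mul_sub,
      ← add_sub_add_left_eq_sub _ _ (M.R s a)] at this
  refine ⟨hF.fixedPoint F, fun s a => ?_⟩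
  exact (congrFun (congrFun hF.fixedPoint_isFixedPt s) a).symm

/-- At a pair where `|q|` attains its maximum `m`, the equation gives `m ≤ r + γ m`. -/
theorem IsBellmanFixed.abs_le {q : S → A → ℝ} (hq : IsBellmanFixed M γ f q) (h0 : 0 ≤ γ)
    (h1 : γ < 1) {r : ℝ} (hr : ∀ s a, |M.R s a| ≤ r) (s : S) (a : A) : |q s a| ≤ r / (1 - γ) := by
  have : Nonempty (S × A) := ⟨(s, a)⟩
  obtain ⟨z, hz⟩ := Finite.exists_max fun z : S × A => |q z.1 z.2|
  have hsup : |⨆ b, q (f z.1 z.2) b| ≤ |q z.1 z.2| := by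
    have := abs_ciSup_sub_ciSup_le (q := q (f z.1 z.2)) (q' := fun _ => 0) (c := |q z.1 z.2|)
      fun b => by simpa using hz (f z.1 z.2, b)
    simpa using this
  have hle : |q z.1 z.2| ≤ r + γ * |q z.1 z.2| := by
    calc |q z.1 z.2| = |M.R z.1 z.2 + γ * ⨆ b, q (f z.1 z.2) b| := by rw [← hq]
      _ ≤ |M.R z.1 z.2| + |γ * ⨆ b, q (f z.1 z.2) b| := abs_add_le _ _
      _ ≤ r + γ * |q z.1 z.2| := by
        rw [abs_mul, abs_of_nonneg h0]
        exact add_le_add (hr _ _) (mul_le_mul_of_nonneg_left hsup h0)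
  refine (hz (s, a)).trans ((le_div_iff₀ (by linarith)).2 ?_)
  linarith

omit [Nonempty A] in
theorem nextExp_eq (hf : ∀ s a, M.P s a = PMF.pure (f s a)) (π : S → PMF A) (h : S × A → ℝ)
    (z : S × A) :
    M.nextExp π h z = (π (f z.1 z.2)).finExp fun a => h (f z.1 z.2, a) := by
  rw [nextExp, hf, PMF.finExp_pure]

omit [Nonempty A] in
theorem IsBellmanFixed.expectedReturn_le {q : S → A → ℝ} (hq : IsBellmanFixed M γ f q)
    (hf : ∀ s a, M.P s a = PMF.pure (f s a)) (h0 : 0 ≤ γ) (h1 : γ < 1) (π : S → PMF A)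
    (μ : PMF (S × A)) : M.expectedReturn γ π μ ≤ μ.finExp fun z => q z.1 z.2 := by
  refine M.expectedReturn_le π h0 h1 μ fun z => ?_
  rw [nextExp_eq hf, hq z.1 z.2]
  gcongr
  rw [← (π (f z.1 z.2)).finExp_const (⨆ b, q (f z.1 z.2) b)]
  exact PMF.finExp_mono _ fun a => finite_le_ciSup (q (f z.1 z.2)) a

omit [Fintype S] in
-- The error `e` is paid twice: at the best action for `q` and at the action played.
theorem IsGreedy.le_finExp {q Q : S → A → ℝ} {e : ℝ} {π : S → PMF A}
    (hQ : ∀ s a, |Q s a - q s a| ≤ e) (hπ : IsGreedy Q π) (s : S) :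
    (⨆ b, q s b) - 2 * e ≤ (π s).finExp (q s) := by
  rw [← (π s).finExp_const ((⨆ b, q s b) - 2 * e)]
  refine PMF.finExp_mono_of_support _ fun a ha => ?_
  rw [sub_le_iff_le_add]
  refine ciSup_le fun b => ?_
  linarith [hπ s a ha b, (abs_le.1 (hQ s a)).2, (abs_le.1 (hQ s b)).1]

/-- The loss carries a factor `γ` because `μ` prescribes the first action; the greedy choice starts
one step later. -/
theorem IsGreedy.le_expectedReturn {q Q : S → A → ℝ} (hq : IsBellmanFixed M γ f q)
    (hf : ∀ s a, M.P s a = PMF.pure (f s a)) (h0 : 0 ≤ γ) (h1 : γ < 1) {e : ℝ} {π : S → PMF A}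
    (hQ : ∀ s a, |Q s a - q s a| ≤ e) (hπ : IsGreedy Q π) (μ : PMF (S × A)) :
    (μ.finExp fun z => q z.1 z.2) - γ * (2 * e) / (1 - γ) ≤ M.expectedReturn γ π μ := by
  refine M.le_expectedReturn π h0 h1 μ fun z => ?_
  rw [nextExp_eq hf, hq z.1 z.2, add_sub_assoc, ← mul_sub]
  gcongr
  exact hπ.le_finExp hQ (f z.1 z.2)

omit [Fintype S] in
theorem exists_isGreedy (Q : S → A → ℝ) : ∃ π : S → PMF A, IsGreedy Q π := by
  choose g hg using fun s => Finite.exists_max (Q s)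
  refine ⟨fun s => PMF.pure (g s), fun s a ha b => ?_⟩
  rw [PMF.support_pure, Set.mem_singleton_iff] at ha
  exact ha ▸ hg s b

omit [Nonempty A] in
theorem IsBellmanFixed.stateValue_le {q : S → A → ℝ} (hq : IsBellmanFixed M γ f q)
    (hf : ∀ s a, M.P s a = PMF.pure (f s a)) (h0 : 0 ≤ γ) (h1 : γ < 1) (π : S → PMF A) (s : S) :
    M.stateValue γ π s ≤ ⨆ b, q s b := by
  refine (hq.expectedReturn_le hf h0 h1 π _).trans ?_
  rw [PMF.finExp_map, ← (π s).finExp_const (⨆ b, q s b)]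
  exact PMF.finExp_mono _ fun a => finite_le_ciSup (q s) a

theorem IsGreedy.le_stateValue {q Q : S → A → ℝ} (hq : IsBellmanFixed M γ f q)
    (hf : ∀ s a, M.P s a = PMF.pure (f s a)) (h0 : 0 ≤ γ) (h1 : γ < 1) {e : ℝ} {π : S → PMF A}
    (hQ : ∀ s a, |Q s a - q s a| ≤ e) (hπ : IsGreedy Q π) (s : S) :
    (⨆ b, q s b) - 2 * e / (1 - γ) ≤ M.stateValue γ π s := by
  have h₁ := hπ.le_expectedReturn hq hf h0 h1 hQ ((π s).map fun a => (s, a))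
  rw [PMF.finExp_map] at h₁
  have h₂ : (⨆ b, q s b) - 2 * e ≤ (π s).finExp ((fun z => q z.1 z.2) ∘ fun a => (s, a)) :=
    hπ.le_finExp hQ s
  -- The loss of the first greedy action plus that of all later ones.
  have h₃ : 2 * e / (1 - γ) = 2 * e + γ * (2 * e) / (1 - γ) := by
    have : 1 - γ ≠ 0 := by linarith
    field_simp
    ring
  rw [stateValue]
  linarith

/-- The fixed point bounds every policy from above, and a policy greedy for `q` itself attains it
(`e = 0`). -/
theorem IsBellmanFixed.optActionValue_eq {q : S → A → ℝ} (hq : IsBellmanFixed M γ f q)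
    (hf : ∀ s a, M.P s a = PMF.pure (f s a)) (h0 : 0 ≤ γ) (h1 : γ < 1) (s : S) (a : A) :
    M.optActionValue γ s a = q s a := by
  have hle : ∀ π : S → PMF A, M.actionValue γ π s a ≤ q s a := fun π =>
    (hq.expectedReturn_le hf h0 h1 π (PMF.pure (s, a))).trans_eq (PMF.finExp_pure _ _)
  obtain ⟨π, hπ⟩ := exists_isGreedy q
  have : Nonempty (S → PMF A) := ⟨π⟩
  refine le_antisymm (ciSup_le hle) ?_
  have hge := hπ.le_expectedReturn hq hf h0 h1 (e := 0) (fun s a => by simp) (PMF.pure (s, a))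
  simp only [PMF.finExp_pure, mul_zero, zero_div, sub_zero] at hge
  exact hge.trans (le_ciSup ⟨_, Set.forall_mem_range.2 hle⟩ π)

theorem IsGreedy.isEpsOptimal {q Q : S → A → ℝ} (hq : IsBellmanFixed M γ f q)
    (hf : ∀ s a, M.P s a = PMF.pure (f s a)) (h0 : 0 ≤ γ) (h1 : γ < 1) {e : ℝ} {π : S → PMF A}
    (hQ : ∀ s a, |Q s a - q s a| ≤ e) (hπ : IsGreedy Q π) :
    M.IsEpsOptimal γ (2 * e / (1 - γ)) π := by
  intro s
  have : Nonempty (S → PMF A) := ⟨π⟩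
  have h₁ := hπ.le_stateValue hq hf h0 h1 hQ s
  have h₂ : M.optStateValue γ s ≤ ⨆ b, q s b :=
    ciSup_le fun π' => hq.stateValue_le hf h0 h1 π' s
  linarith

omit [Fintype S] in
/-- Each step of Q-learning on exact samples contracts the error by `1 - α (1 - γ)`. -/
theorem IsBellmanFixed.abs_qLearning_sub_le {q Q₀ : S → A → ℝ} (hq : IsBellmanFixed M γ f q)
    (h0 : 0 ≤ γ) {α : ℕ → ℝ} (hα0 : ∀ t, 0 ≤ α t) (hα1 : ∀ t, α t ≤ 1) {y : ℕ × S × A → S}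
    (hy : ∀ i, y i = f i.2.1 i.2.2) {e : ℝ} (he : 0 ≤ e) (hQ₀ : ∀ s a, |Q₀ s a - q s a| ≤ e)
    (t : ℕ) (s : S) (a : A) :
    |M.qLearning γ α Q₀ y t s a - q s a| ≤
      e * Real.exp (-((1 - γ) * ∑ i ∈ Finset.range t, α i)) := by
  induction t generalizing s a with
  | zero => simpa [qLearning] using hQ₀ s a
  | succ t ih =>
    set E := e * Real.exp (-((1 - γ) * ∑ i ∈ Finset.range t, α i)) with hE
    have hE0 : 0 ≤ E := by positivity
    have hsup := abs_ciSup_sub_ciSup_le fun b => ih (f s a) b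
    -- `α t` times the fixed-point equation is subtracted from the update, so the reward cancels.
    have hrec : M.qLearning γ α Q₀ y (t + 1) s a - q s a =
        (1 - α t) * (M.qLearning γ α Q₀ y t s a - q s a)
          + α t * (γ * ((⨆ b, M.qLearning γ α Q₀ y t (f s a) b) - ⨆ b, q (f s a) b)) := by
      have h₁ := hq s a
      simp only [qLearning, hy]
      linear_combination (-α t) * h₁
    have hstep : |M.qLearning γ α Q₀ y (t + 1) s a - q s a| ≤ E * (1 - (1 - γ) * α t) := by
      rw [hrec]
      refine (abs_add_le _ _).trans ?_
      rw [abs_mul, abs_mul, abs_mul, abs_of_nonneg (sub_nonneg.2 (hα1 t)),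
        abs_of_nonneg (hα0 t), abs_of_nonneg h0]
      have h₁ := mul_le_mul_of_nonneg_left (ih s a) (sub_nonneg.2 (hα1 t))
      have h₂ := mul_le_mul_of_nonneg_left (mul_le_mul_of_nonneg_left hsup h0) (hα0 t)
      linarith
    refine hstep.trans ?_
    rw [Finset.sum_range_succ, mul_add, neg_add, Real.exp_add, ← mul_assoc, ← hE]
    refine mul_le_mul_of_nonneg_left ?_ hE0
    linarith [Real.add_one_le_exp (-((1 - γ) * α t))]

theorem IsBellmanFixed.qLearningSucceeds {q Q₀ : S → A → ℝ} (hq : IsBellmanFixed M γ f q)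
    (hf : ∀ s a, M.P s a = PMF.pure (f s a)) (h0 : 0 ≤ γ) (h1 : γ < 1) {α : ℕ → ℝ} {t : ℕ}
    {y : ℕ × S × A → S} {ε : ℝ} (hε : 0 ≤ ε)
    (hQ : ∀ s a, |M.qLearning γ α Q₀ y t s a - q s a| ≤ ε * (1 - γ) / 2) :
    M.QLearningSucceeds γ α Q₀ ε t y := by
  refine ⟨fun s a => ?_, fun π hπ => ?_⟩
  · rw [hq.optActionValue_eq hf h0 h1]
    refine (hQ s a).trans ?_
    nlinarith
  · have := hπ.isEpsOptimal hq hf h0 h1 hQ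
    have hne : 1 - γ ≠ 0 := by linarith
    rwa [show 2 * (ε * (1 - γ) / 2) / (1 - γ) = ε by field_simp] at this

end Deterministic

/-! ### Almost sure exactness of the samples -/

section Samples

variable [Fintype S] [Fintype A] {M : FiniteMDP S A} {f : S → A → S}

/-- The index set is countable, so almost surely all samples are exact at once. `E` is almost
everywhere equal to `Set.univ`, so its measurability is not needed. -/
theorem sampleLaw_eq_one (hf : ∀ s a, M.P s a = PMF.pure (f s a)) {E : Set (ℕ × S × A → S)}
    (hE : ∀ y : ℕ × S × A → S, (∀ i, y i = f i.2.1 i.2.2) → y ∈ E) : M.sampleLaw E = 1 := by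
  let : MeasurableSpace S := ⊤
  have hP : ∀ i : ℕ × S × A, IsProbabilityMeasure (M.P i.2.1 i.2.2).toMeasure :=
    fun i => PMF.toMeasure.isProbabilityMeasure _
  change Measure.infinitePi (fun i : ℕ × S × A => (M.P i.2.1 i.2.2).toMeasure) E = 1
  set ν := Measure.infinitePi fun i : ℕ × S × A => (M.P i.2.1 i.2.2).toMeasure with hν
  have hae : ∀ᵐ y ∂ν, ∀ i, y i = f i.2.1 i.2.2 := by
    refine ae_all_iff.2 fun i => ?_
    have hd : ∀ᵐ s ∂(M.P i.2.1 i.2.2).toMeasure, s = f i.2.1 i.2.2 := by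
      rw [hf, PMF.toMeasure_pure]
      exact (ae_dirac_iff (measurableSet_singleton (f i.2.1 i.2.2))).2 rfl
    have hm : MeasurePreserving (Function.eval i) ν (M.P i.2.1 i.2.2).toMeasure :=
      measurePreserving_eval_infinitePi _ i
    exact hm.quasiMeasurePreserving.ae hd
  rw [measure_congr (t := Set.univ), measure_univ]
  filter_upwards [hae] with y hy
  exact propext ⟨fun _ => trivial, fun _ => hE y hy⟩

end Samples

/-! ### Learning rates and iteration count -/

/-- Each of the first `t` rates is at least `t ^ (-ω)`. -/
theorem rpow_le_sum_polyRate {ω : ℝ} (hω : 0 ≤ ω) {t : ℕ} (ht : 0 < t) :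
    (t : ℝ) ^ (1 - ω) ≤ ∑ i ∈ Finset.range t, polyRate ω i := by
  have ht' : (0 : ℝ) < t := by exact_mod_cast ht
  have h : ∀ i ∈ Finset.range t, ((t : ℝ) ^ ω)⁻¹ ≤ polyRate ω i := by
    intro i hi
    rw [polyRate, one_div]
    have : (i : ℝ) + 1 ≤ t := by exact_mod_cast Finset.mem_range.1 hi
    gcongr
  have := Finset.card_nsmul_le_sum _ _ _ h
  rw [Real.rpow_sub ht', Real.rpow_one]
  rwa [Finset.card_range, nsmul_eq_mul, ← div_eq_mul_inv] at this

theorem polyRate_nonneg (ω : ℝ) (t : ℕ) : 0 ≤ polyRate ω t := by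
  unfold polyRate; positivity

theorem polyRate_le_one {ω : ℝ} (hω : 0 ≤ ω) (t : ℕ) : polyRate ω t ≤ 1 := by
  have : (1 : ℝ) ≤ ((t : ℝ) + 1) ^ ω := Real.one_le_rpow (by linarith [t.cast_nonneg (α := ℝ)]) hω
  exact div_le_one_of_le₀ this (by positivity)

/-- Q-learning on a deterministic MDP needs at most `2 W` iterations, when `W` iterations make the
worst-case error `2 r / (1 - γ) · exp (-(1 - γ) W ^ (1 - ω))` at most `ε (1 - γ) / 2`. -/
theorem sampleComplexity_le [Fintype S] [Fintype A] {M : FiniteMDP S A}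
    (hM : M.IsDeterministic) [Nonempty A] {γ ε δ ω r W B : ℝ} (h0 : 0 ≤ γ) (h1 : γ < 1)
    (hr : 0 < r) (hR : ∀ s a, |M.R s a| ≤ r) (hε : 0 < ε) (hδ : 0 ≤ δ) (hω : 0 ≤ ω) (hω1 : ω ≤ 1)
    (hW : 1 ≤ W) (hB : 2 * W ≤ B)
    (hlog : Real.log (4 * r / (ε * (1 - γ) ^ 2)) ≤ (1 - γ) * W ^ (1 - ω))
    {Q₀ : S → A → ℝ} (hQ₀ : ∀ s a, |Q₀ s a| ≤ r / (1 - γ)) :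
    (M.sampleComplexity γ (polyRate ω) Q₀ ε δ : ℝ≥0∞) ≤ ENNReal.ofReal B := by
  choose f hf using hM
  obtain ⟨q, hq⟩ := exists_isBellmanFixed M f h0 h1
  have hu : 0 < 1 - γ := by linarith
  have hmem : ⌊B⌋₊ ∈ {N : ℕ | ∀ T, N ≤ T → ENNReal.ofReal (1 - δ) ≤
      M.sampleLaw {y | M.QLearningSucceeds γ (polyRate ω) Q₀ ε T y}} := by
    intro T hT
    -- The factor 2 in `2 * W ≤ B` absorbs the floor: `⌊B⌋₊ > 2 W - 1 ≥ W`.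
    have hWT : W ≤ T := by
      have h₁ := Nat.lt_floor_add_one B
      have h₂ : (⌊B⌋₊ : ℝ) ≤ T := by exact_mod_cast hT
      linarith
    have hT0 : 0 < T := by
      have : (0 : ℝ) < T := by linarith
      exact_mod_cast this
    rw [sampleLaw_eq_one hf, ENNReal.ofReal_le_one]
    · linarith
    intro y hy
    refine hq.qLearningSucceeds hf h0 h1 hε.le fun s a => ?_
    have he : ∀ s a, |Q₀ s a - q s a| ≤ 2 * r / (1 - γ) := fun s a => by
      have := abs_sub (Q₀ s a) (q s a)
      have h₃ := hq.abs_le h0 h1 hR s a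
      have h₄ := hQ₀ s a
      rw [two_mul, add_div]
      linarith
    refine (hq.abs_qLearning_sub_le h0 (polyRate_nonneg ω) (polyRate_le_one hω) hy
      (by positivity) he T s a).trans ?_
    have hexp : Real.log (4 * r / (ε * (1 - γ) ^ 2)) ≤
        (1 - γ) * ∑ i ∈ Finset.range T, polyRate ω i := by
      refine hlog.trans (mul_le_mul_of_nonneg_left ?_ hu.le)
      refine le_trans ?_ (rpow_le_sum_polyRate hω hT0)
      exact Real.rpow_le_rpow (by linarith) hWT (by linarith)
    calc 2 * r / (1 - γ) * Real.exp (-((1 - γ) * ∑ i ∈ Finset.range T, polyRate ω i))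
        ≤ 2 * r / (1 - γ) * Real.exp (-Real.log (4 * r / (ε * (1 - γ) ^ 2))) := by gcongr
      _ = ε * (1 - γ) / 2 := by
        rw [Real.exp_neg, Real.exp_log (by positivity)]
        field_simp
        ring
  have hle : M.sampleComplexity γ (polyRate ω) Q₀ ε δ ≤ (⌊B⌋₊ : ℕ∞) := iInf₂_le _ hmem
  calc (M.sampleComplexity γ (polyRate ω) Q₀ ε δ : ℝ≥0∞) ≤ ((⌊B⌋₊ : ℕ∞) : ℝ≥0∞) := by
        exact_mod_cast hle
    _ = ENNReal.ofReal (⌊B⌋₊ : ℝ) := by simp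
    _ ≤ ENNReal.ofReal B := ENNReal.ofReal_le_ofReal (Nat.floor_le (by linarith))

/-! ### Determinism and reward bound of the abstract MDP -/

section Abstract

theorem IsDeterministic.augmented [Fintype S] {M : FiniteMDP S A} (hM : M.IsDeterministic)
    (Δ : ℕ) : (M.augmented Δ).IsDeterministic := by
  intro x a
  obtain ⟨s', hs'⟩ := hM x.1 ((Fin.snoc (α := fun _ => A) x.2 a : Fin (Δ + 1) → A) 0)
  refine ⟨(s', Fin.tail (Fin.snoc (α := fun _ => A) x.2 a : Fin (Δ + 1) → A)), ?_⟩
  simp only [FiniteMDP.augmented, hs', PMF.pure_map]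

theorem IsDeterministic.quotient {M : FiniteMDP S A} (hM : M.IsDeterministic) {r : Setoid S}
    (hR : M.IsRewardRespecting r) (hP : M.HasSSP r) : (M.quotient r hR hP).IsDeterministic := by
  intro x a
  induction x using Quotient.inductionOn with
  | h s =>
    obtain ⟨s', hs'⟩ := hM s a
    refine ⟨Quotient.mk r s', ?_⟩
    rw [← PMF.pure_map, ← hs']
    rfl

theorem abs_abstractMDP_R_le [Fintype S] {M : FiniteMDP S A} (hM : M.IsDeterministic) (Δ : ℕ)
    {r : ℝ} (hr : ∀ s a, |M.R s a| ≤ r) (x : M.AbstractState Δ) (a : A) :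
    |(M.abstractMDP hM Δ).R x a| ≤ r := by
  induction x using Quotient.inductionOn with
  | h z => exact (M.belief Δ z).abs_finExp_le fun s => hr s a

end Abstract

/-- The bound of `sampleComplexity_le` for the abstract MDPs and the delay-free MDP at once. -/
theorem sampleComplexity_abstractMDP_le [Fintype S] [Fintype A] {M : FiniteMDP S A}
    (hM : M.IsDeterministic) {γ ε δ ω r W B : ℝ} (hcard : 2 ≤ Fintype.card S * Fintype.card A)
    (h0 : 0 ≤ γ) (h1 : γ < 1) (hr : 0 < r) (hR : ∀ s a, |M.R s a| ≤ r) (hε : 0 < ε) (hδ : 0 ≤ δ)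
    (hω : 0 ≤ ω) (hω1 : ω ≤ 1) (hW : 1 ≤ W) (hB : 2 * W ≤ B)
    (hlog : Real.log (4 * r / (ε * (1 - γ) ^ 2)) ≤ (1 - γ) * W ^ (1 - ω)) :
    (∀ (Δ : ℕ) (Q₀ : M.AbstractState Δ → A → ℝ), (∀ x a, |Q₀ x a| ≤ r / (1 - γ)) →
      ((M.abstractMDP hM Δ).sampleComplexity γ (polyRate ω) Q₀ ε δ : ℝ≥0∞) ≤
        ENNReal.ofReal B) ∧
    (∀ Q₀ : S → A → ℝ, (∀ s a, |Q₀ s a| ≤ r / (1 - γ)) →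
      (M.sampleComplexity γ (polyRate ω) Q₀ ε δ : ℝ≥0∞) ≤ ENNReal.ofReal B) := by
  have : Nonempty A := by
    rw [← Fintype.card_pos_iff]
    by_contra h
    simp [Nat.eq_zero_of_not_pos h] at hcard
  exact ⟨fun Δ Q₀ hQ₀ => sampleComplexity_le ((hM.augmented Δ).quotient _ _) h0 h1 hr
      (abs_abstractMDP_R_le hM Δ hR) hε hδ hω hω1 hW hB hlog hQ₀,
    fun Q₀ hQ₀ => sampleComplexity_le hM h0 h1 hr hR hε hδ hω hω1 hW hB hlog hQ₀⟩

end FiniteMDP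

/-! ### Real inequalities for the choice of `W` -/

theorem log_horizon_eq {r ε u : ℝ} (hr : 0 < r) (hε : 0 < ε) (hu : 0 < u) :
    Real.log (4 * r / (ε * u ^ 2)) =
      Real.log (4 * r) + Real.log ε⁻¹ + 2 * Real.log u⁻¹ := by
  rw [Real.log_div (by positivity) (by positivity), Real.log_mul hε.ne' (by positivity),
    Real.log_pow, Real.log_inv, Real.log_inv]
  push_cast
  ring

/-- `X` is a power of `ε⁻¹`; `Y` is a power of `u⁻¹`, or the logarithmic factor at the boundary
rate. Both are at least 1, so the product absorbs each of the three terms. -/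
theorem log_horizon_le {r ε u X Y k : ℝ} (hr : 0 < r) (hε : 0 < ε) (hu : 0 < u)
    (hX : 1 ≤ X) (hY : 1 ≤ Y) (hk : 0 ≤ k) (hεX : Real.log ε⁻¹ ≤ 2 * X)
    (huY : Real.log u⁻¹ ≤ k * Y) :
    Real.log (4 * r / (ε * u ^ 2)) ≤ (4 * r + 2 + 2 * k) * (X * Y) := by
  rw [log_horizon_eq hr hε hu]
  have h₁ : Real.log (4 * r) ≤ 4 * r := Real.log_le_self (by positivity)
  have h₂ : X ≤ X * Y := le_mul_of_one_le_right (by linarith) hY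
  have h₃ : Y ≤ X * Y := le_mul_of_one_le_left (by linarith) hX
  have h₄ : 1 ≤ X * Y := hX.trans h₂
  nlinarith [mul_le_mul_of_nonneg_left h₃ hk, mul_le_mul_of_nonneg_left h₄ hr.le]

/-- The number of iterations of order `ε ^ (-2.5) u ^ (-5)` raised to the power `p`. -/
theorem horizon_rpow {K ε u p : ℝ} (hK : 0 ≤ K) (hε : 0 < ε) (hu : 0 < u) (hp : 0 < p) :
    u * (K ^ (1 / p) * ((ε⁻¹) ^ (2.5 : ℝ) * (u⁻¹) ^ (5 : ℝ))) ^ p =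
      K * ((ε⁻¹) ^ (2.5 * p) * (u⁻¹) ^ (5 * p - 1)) := by
  rw [Real.mul_rpow (by positivity) (by positivity), Real.mul_rpow (by positivity) (by positivity),
    ← Real.rpow_mul hK, ← Real.rpow_mul (by positivity), ← Real.rpow_mul (by positivity),
    one_div_mul_cancel hp.ne', Real.rpow_one, Real.rpow_sub (by positivity), Real.rpow_one]
  field_simp

/-- `log x ≤ 2 √x`, and `p ≥ 1 / 5` is exactly `2.5 p ≥ 1 / 2`. -/
theorem log_inv_le_two_mul_rpow {ε p : ℝ} (hε : 0 < ε) (hε1 : ε ≤ 1) (hp : 1 / 5 ≤ p) :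
    Real.log ε⁻¹ ≤ 2 * (ε⁻¹) ^ (2.5 * p) := by
  have h₁ := Real.log_le_rpow_div (x := ε⁻¹) (by positivity) (ε := 1 / 2) (by norm_num)
  have h₂ : (ε⁻¹) ^ (1 / 2 : ℝ) ≤ (ε⁻¹) ^ (2.5 * p) :=
    Real.rpow_le_rpow_of_exponent_le ((one_le_inv₀ hε).2 hε1) (by linarith)
  linarith

/-- `n` stands for `log (|S| |A|)`, inserted through `n / log 2 ≥ 1`; `k` keeps the logarithmic
factor out of the constant. -/
theorem two_mul_horizon_le {n K ε u k : ℝ} (hn : Real.log 2 ≤ n) (hK : 0 ≤ K) (hε : 0 < ε)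
    (hu : 0 < u) (hk : 0 ≤ k) :
    2 * (K * k * ((ε⁻¹) ^ (2.5 : ℝ) * (u⁻¹) ^ (5 : ℝ))) ≤
      2 / Real.log 2 * K * k * (n / (ε ^ (2.5 : ℝ) * u ^ 5)) := by
  have hl : 0 < Real.log 2 := Real.log_pos one_lt_two
  rw [Real.inv_rpow hε.le, Real.inv_rpow hu.le, ← mul_inv,
    show u ^ (5 : ℝ) = u ^ 5 by exact_mod_cast Real.rpow_natCast u 5]
  have h₁ : 1 ≤ n / Real.log 2 := (one_le_div hl).2 hn
  have h₂ : 0 ≤ 2 * (K * k * (ε ^ (2.5 : ℝ) * u ^ 5)⁻¹) := by positivity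
  calc _ ≤ 2 * (K * k * (ε ^ (2.5 : ℝ) * u ^ 5)⁻¹) * (n / Real.log 2) :=
        le_mul_of_one_le_right h₂ h₁
    _ = _ := by ring

theorem log_two_le_log_card_mul_card {m n : ℕ} (h : 2 ≤ m * n) :
    Real.log 2 ≤ Real.log ((m : ℝ) * (n : ℝ)) :=
  Real.log_le_log two_pos (by exact_mod_cast h)

theorem one_le_horizon {K ε u : ℝ} (hK : 1 ≤ K) (hε : 0 < ε) (hε1 : ε ≤ 1) (hu : 0 < u)
    (hu1 : u ≤ 1) : 1 ≤ K * ((ε⁻¹) ^ (2.5 : ℝ) * (u⁻¹) ^ (5 : ℝ)) :=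
  one_le_mul_of_one_le_of_one_le hK <| one_le_mul_of_one_le_of_one_le
    (Real.one_le_rpow ((one_le_inv₀ hε).2 hε1) (by norm_num))
    (Real.one_le_rpow ((one_le_inv₀ hu).2 hu1) (by norm_num))

theorem corollary3p6 (Rmax : ℝ) (hRmax : 0 < Rmax) :
    -- learning rates `1 / (t + 1) ^ ω` with `0 ≤ ω < 4 / 5`
    (∀ ω : ℝ, 0 ≤ ω → ω < 4 / 5 →
      ∃ C : ℝ, 0 < C ∧
        ∀ (S : Type u) (A : Type v) [Fintype S] [Fintype A] (M : FiniteMDP S A)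
          (hM : M.IsDeterministic) (γ ε δ : ℝ),
          2 ≤ Fintype.card S * Fintype.card A → (∀ s a, |M.R s a| ≤ Rmax) →
          0 ≤ γ → γ < 1 → 0 < ε → ε ≤ 1 → 0 < δ → δ < 1 →
          -- the abstract MDP, for every delay
          (∀ (Δ : ℕ) (Q₀ : M.AbstractState Δ → A → ℝ), (∀ x a, |Q₀ x a| ≤ Rmax / (1 - γ)) →
            ((M.abstractMDP hM Δ).sampleComplexity γ (polyRate ω) Q₀ ε δ : ℝ≥0∞) ≤
              ENNReal.ofReal (C * (Real.log ((Fintype.card S : ℝ) * (Fintype.card A : ℝ)) /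
                (ε ^ (2.5 : ℝ) * (1 - γ) ^ 5)))) ∧
          -- the delay-free MDP
          (∀ Q₀ : S → A → ℝ, (∀ s a, |Q₀ s a| ≤ Rmax / (1 - γ)) →
            (M.sampleComplexity γ (polyRate ω) Q₀ ε δ : ℝ≥0∞) ≤
              ENNReal.ofReal (C * (Real.log ((Fintype.card S : ℝ) * (Fintype.card A : ℝ)) /
                (ε ^ (2.5 : ℝ) * (1 - γ) ^ 5))))) ∧
    -- the boundary rate `1 / (t + 1) ^ (4 / 5)`, up to a logarithmic factor in `1 / (1 - γ)`
    (∃ C : ℝ, 0 < C ∧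
      ∀ (S : Type u) (A : Type v) [Fintype S] [Fintype A] (M : FiniteMDP S A)
        (hM : M.IsDeterministic) (γ ε δ : ℝ),
        2 ≤ Fintype.card S * Fintype.card A → (∀ s a, |M.R s a| ≤ Rmax) →
        0 ≤ γ → γ < 1 → 0 < ε → ε ≤ 1 → 0 < δ → δ < 1 →
        (∀ (Δ : ℕ) (Q₀ : M.AbstractState Δ → A → ℝ), (∀ x a, |Q₀ x a| ≤ Rmax / (1 - γ)) →
          ((M.abstractMDP hM Δ).sampleComplexity γ (polyRate (4 / 5)) Q₀ ε δ : ℝ≥0∞) ≤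
            ENNReal.ofReal (C * (1 + Real.log (1 / (1 - γ))) ^ 5 *
              (Real.log ((Fintype.card S : ℝ) * (Fintype.card A : ℝ)) /
                (ε ^ (2.5 : ℝ) * (1 - γ) ^ 5)))) ∧
        (∀ Q₀ : S → A → ℝ, (∀ s a, |Q₀ s a| ≤ Rmax / (1 - γ)) →
          (M.sampleComplexity γ (polyRate (4 / 5)) Q₀ ε δ : ℝ≥0∞) ≤
            ENNReal.ofReal (C * (1 + Real.log (1 / (1 - γ))) ^ 5 *
              (Real.log ((Fintype.card S : ℝ) * (Fintype.card A : ℝ)) /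
                (ε ^ (2.5 : ℝ) * (1 - γ) ^ 5))))) := by
  constructor
  · intro ω hω hω1
    set p := 1 - ω with hp
    have hη : 0 < 5 * p - 1 := by linarith
    -- The constant of `log_horizon_le` with `k = 1 / (5 p - 1)`, from `log x ≤ x ^ η / η` with `η =
    -- 5 p - 1`.
    set K := 4 * Rmax + 2 + 2 * (1 / (5 * p - 1)) with hK
    have hK1 : 1 ≤ K := by
      have : 0 < 1 / (5 * p - 1) := by positivity
      linarith
    have hKp : 1 ≤ K ^ (1 / p) := Real.one_le_rpow hK1 (by
      have : 0 < p := by linarith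
      positivity)
    have hl : 0 < Real.log 2 := Real.log_pos one_lt_two
    refine ⟨2 / Real.log 2 * K ^ (1 / p), by positivity, ?_⟩
    intro S A _ _ M hM γ ε δ hcard hR h0 h1 hε hε1 hδ hδ1
    have hu : 0 < 1 - γ := by linarith
    have hu1 : 1 - γ ≤ 1 := by linarith
    refine FiniteMDP.sampleComplexity_abstractMDP_le hM hcard h0 h1 hRmax hR hε hδ.le hω
      (by linarith) (one_le_horizon hKp hε hε1 hu hu1) ?_ ?_
    · have := two_mul_horizon_le (log_two_le_log_card_mul_card hcard)
        (zero_le_one.trans hKp) hε hu zero_le_one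
      simpa only [mul_one] using this
    · rw [horizon_rpow (by linarith) hε hu (by linarith)]
      refine log_horizon_le hRmax hε hu
        (Real.one_le_rpow ((one_le_inv₀ hε).2 hε1) (by linarith))
        (Real.one_le_rpow ((one_le_inv₀ hu).2 hu1) hη.le) (by positivity)
        (log_inv_le_two_mul_rpow hε hε1 (by linarith)) ?_
      rw [one_div_mul_eq_div]
      exact Real.log_le_rpow_div (by positivity) hη
  -- Here `k = 1`, since `log u⁻¹ ≤ L`.
  · set K := 4 * Rmax + 2 + 2 * 1 with hK
    have hK1 : 1 ≤ K := by linarith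
    have hl : 0 < Real.log 2 := Real.log_pos one_lt_two
    refine ⟨2 / Real.log 2 * K ^ 5, by positivity, ?_⟩
    intro S A _ _ M hM γ ε δ hcard hR h0 h1 hε hε1 hδ hδ1
    have hu : 0 < 1 - γ := by linarith
    have hu1 : 1 - γ ≤ 1 := by linarith
    have hL : 1 ≤ 1 + Real.log (1 / (1 - γ)) := by
      have := Real.log_nonneg ((one_le_div hu).2 hu1)
      linarith
    set L := 1 + Real.log (1 / (1 - γ)) with hLdef
    have hKL : 1 ≤ K ^ 5 * L ^ 5 :=
      one_le_mul_of_one_le_of_one_le (one_le_pow₀ hK1) (one_le_pow₀ hL)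
    refine FiniteMDP.sampleComplexity_abstractMDP_le hM hcard h0 h1 hRmax hR hε hδ.le
      (by norm_num) (by norm_num) (one_le_horizon hKL hε hε1 hu hu1)
      (two_mul_horizon_le (log_two_le_log_card_mul_card hcard) (by positivity) hε hu
        (by positivity)) ?_
    -- The fifth power of the logarithm is `1 / p` for `p = 1 / 5`.
    have hpow : K ^ 5 * L ^ 5 = (K * L) ^ (1 / (1 - 4 / 5 : ℝ)) := by
      rw [← mul_pow, ← Real.rpow_natCast]
      norm_num
    -- The exponent of `u⁻¹` is zero; `L` now plays the role of `Y`.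
    rw [hpow, horizon_rpow (by positivity) hε hu (by norm_num),
      show 5 * (1 - 4 / 5 : ℝ) - 1 = 0 by norm_num, Real.rpow_zero, mul_one, mul_assoc,
      mul_comm L]
    refine log_horizon_le hRmax hε hu
      (Real.one_le_rpow ((one_le_inv₀ hε).2 hε1) (by norm_num)) hL zero_le_one
      (log_inv_le_two_mul_rpow hε hε1 (by norm_num)) ?_
    rw [hLdef, one_div]
    linarith
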